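/- Let $\mathbf F$ be a finite field with $q$ elements and let $\mathcal X$ be a projective, geometrically irreducible, non-singular algebraic curve over $\mathbf F$ with function field $\mathbf F(\mathcal X)$. For an $\mathbf F$-divisor $A$ on $\mathcal X$ put $\mathcal L(A)=\{f\in\mathbf F(\mathcal X)^*:\operatorname{div}(f)+A\succeq 0\}\cup\{0\}$ and $\ell(A)=\dim_{\mathbf F}\mathcal L(A)$. Let $n\ge 1$, let $P_1,\dots,P_n$ be pairwise distinct $\mathbf F$-rational points of $\mathcal X$, let $D=P_1+\dots+P_n$, and let $G$ be an $\mathbf F$-divisor whose support is disjoint from that of $D$. Let $$\mathcal C=\mathcal C_{\mathcal X}(D,G)=\{(f(P_1),\dots,f(P_n)) : f\in\mathcal L(G)\}\subseteq\mathbf F^n$$ be the associated AG code, $k=\dim_{\mathbf F}\mathcal C$ its dimension and $a=\ell(G-D)$ its abundance. A trellis of depth $n$ is a finite directed graph with edges labelled by elements of $\mathbf F$, whose vertex set is a disjoint union $V_0\sqcup\dots\sqcup V_n$ with $|V_0|=|V_n|=1$, such that every edge starting in $V_i$ ends in $V_{i+1}$ and every vertex lies on a path from $V_0$ to $V_n$.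 It represents a code $\mathcal C'\subseteq\mathbf F^n$ if the set of label sequences of its paths from $V_0$ to $V_n$ is exactly $\mathcal C'$. Its state complexity is $\max_{0\le i\le n}\log_q|V_i|$. A minimal trellis of $\mathcal C'$ is a trellis representing $\mathcal C'$ for which each $|V_i|$, $0\le i\le n$, is smallest possible among all trellises representing $\mathcal C'$; for linear codes such a trellis exists and is unique up to isomorphism. The trellis state complexity $s(\mathcal C)$ of a linear code $\mathcal C\subseteq\mathbf F^n$ is the minimum, over all reorderings of the $n$ coordinates, of the state complexity of the minimal trellis of the reordered code. Then $$s(\mathcal C)\ \ge\ k+2a-\ell(2G-D)-1 .$$ -/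

import Mathlib

universe u

/-! ## Trellises and trellis state complexity -/

/-- A trellis of depth `n` over the label alphabet `F`: a finite edge-labelled directed graph whose
vertex set is the disjoint union of `V 0, …, V n`, with `V 0` and `V n` one-element sets, in which
every edge starting in `V i` ends in `V (i + 1)` and every vertex lies on a path from `V 0` to
`V n`.  Edges are triples (initial vertex, label, final vertex). -/
structure Trellis (F : Type u) (n : ℕ) where
  V : Fin (n + 1) → Type
  finite : ∀ i, Finite (V i)
  E : ∀ i : Fin n, V i.castSucc → F → V i.succ → Prop
  start : Nat.card (V 0) = 1
  finish : Nat.card (V (Fin.last n)) = 1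
  on_path : ∀ (i : Fin (n + 1)) (v : V i), ∃ (p : ∀ j, V j) (w : Fin n → F),
    (∀ j : Fin n, E j (p j.castSucc) (w j) (p j.succ)) ∧ p i = v

namespace Trellis

variable {F : Type u} {n : ℕ}

/-- The `n`-tuples of labels read along the paths from `V 0` to `V n`. -/
def words (T : Trellis F n) : Set (Fin n → F) :=
  {w | ∃ p : ∀ j, T.V j, ∀ j : Fin n, T.E j (p j.castSucc) (w j) (p j.succ)}

/-- `T` represents the block code `C`. -/
def Represents (T : Trellis F n) (C : Set (Fin n → F)) : Prop :=
  T.words = C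

/-- `s_i(T) = log_q |V_i|` with `q = |F|`. -/
noncomputable def s (T : Trellis F n) (i : Fin (n + 1)) : ℝ :=
  Real.logb (Nat.card F) (Nat.card (T.V i))

/-- The state complexity `max (s_0(T), …, s_n(T))` of a trellis. -/
noncomputable def stateComplexity (T : Trellis F n) : ℝ :=
  Finset.univ.sup' Finset.univ_nonempty T.s

/-- `T` is a minimal trellis of `C`: it represents `C`, and at every depth it has the smallest
number of vertices among all trellises that represent `C`. -/
def IsMinimal (T : Trellis F n) (C : Set (Fin n → F)) : Prop :=
  T.Represents C ∧ ∀ T' : Trellis F n, T'.Represents C → ∀ i, T.s i ≤ T'.s i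

end Trellis

/-- The code obtained from `C` by reordering the coordinates by `σ`. -/
def permutedCode {F : Type u} [Field F] {n : ℕ} (C : Submodule F (Fin n → F))
    (σ : Equiv.Perm (Fin n)) : Submodule F (Fin n → F) :=
  C.map (LinearMap.funLeft F F σ)

/-- The trellis state complexity `s(C)` of a linear code: the minimum, over all orderings of the
coordinates, of the state complexity of the minimal trellis of the reordered code. -/
noncomputable def trellisStateComplexity {F : Type u} [Field F] {n : ℕ}
    (C : Submodule F (Fin n → F)) : ℝ :=
  sInf {x : ℝ | ∃ (σ : Equiv.Perm (Fin n)) (T : Trellis F n),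
    T.IsMinimal (permutedCode C σ : Set (Fin n → F)) ∧ x = T.stateComplexity}

/-! ## Curves, divisors and algebraic geometric codes -/

open CategoryTheory AlgebraicGeometry in
/-- A curve over the field `F`: a proper (equivalently, in dimension one, projective),
geometrically irreducible, non-singular `F`-scheme of dimension one.  (Integrality follows from the
other conditions.) -/
structure Curve (F : Type u) [Field F] where
  X : Scheme.{u}
  π : X ⟶ Spec (CommRingCat.of F)
  isIntegral : IsIntegral X
  isProper : IsProper π
  geometricallyIrreducible : GeometricallyIrreducible π
  dim_eq_one : topologicalKrullDim X = 1
  regular : ∀ x : X, IsRegularLocalRing (X.presheaf.stalk x)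

namespace Curve

open CategoryTheory AlgebraicGeometry

variable {F : Type u} [Field F] (𝒳 : Curve F)

instance : IsIntegral 𝒳.X := 𝒳.isIntegral

instance : IsProper 𝒳.π := 𝒳.isProper

instance : IsLocallyNoetherian 𝒳.X := LocallyOfFiniteType.isLocallyNoetherian 𝒳.π

/-- The points of codimension one, that is, the closed points of the curve. -/
abbrev Point : Type u := {x : 𝒳.X // Order.coheight x = 1}

/-- The local rings at the closed points are discrete valuation rings. -/
instance isDiscreteValuationRing_stalk (P : 𝒳.Point) :
    IsDiscreteValuationRing (𝒳.X.presheaf.stalk P.1) := by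
  have hreg := 𝒳.regular P.1
  rw [← IsLocalRing.finrank_CotangentSpace_eq_one_iff]
  have h := (IsRegularLocalRing.iff_finrank_cotangentSpace _).1 hreg
  rw [ringKrullDim_stalk_eq_coheight, P.2] at h
  exact_mod_cast h

/-- The structure map from the constants to the global functions. -/
noncomputable def globalConst : F →+* Γ(𝒳.X, ⊤) :=
  𝒳.π.appTop.hom.comp (Scheme.ΓSpecIso (CommRingCat.of F)).inv.hom

/-- The `F`-algebra structure on the local rings (and on the function field, which is the local
ring at the generic point) given by the structure morphism of the curve. -/
noncomputable instance (x : 𝒳.X) : Algebra F (𝒳.X.presheaf.stalk x) :=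
  ((𝒳.X.presheaf.germ ⊤ x trivial).hom.comp 𝒳.globalConst).toAlgebra

/-- The function field `F(𝒳)`. -/
noncomputable abbrev FunctionField : Type u := 𝒳.X.functionField

/-- `F`-divisors: finite formal `ℤ`-linear combinations of closed points. -/
abbrev Divisor : Type u := 𝒳.Point →₀ ℤ

variable {𝒳}

/-- `P` is an `F`-rational point: its residue field is `F`. -/
def IsRational (P : 𝒳.Point) : Prop :=
  Function.Bijective fun c : F =>
    𝒳.X.residue P.1 (algebraMap F (𝒳.X.presheaf.stalk P.1) c)

/-- The rational function `f` is regular at `P` and takes there the value `f(P) = c ∈ F`. -/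
def HasValueAt (f : 𝒳.FunctionField) (P : 𝒳.Point) (c : F) : Prop :=
  ∃ t : 𝒳.X.presheaf.stalk P.1, algebraMap (𝒳.X.presheaf.stalk P.1) 𝒳.FunctionField t = f ∧
    𝒳.X.residue P.1 t = 𝒳.X.residue P.1 (algebraMap F (𝒳.X.presheaf.stalk P.1) c)

lemma algebraMap_stalk_const (x : 𝒳.X) (c : F) :
    algebraMap (𝒳.X.presheaf.stalk x) 𝒳.FunctionField
      (algebraMap F (𝒳.X.presheaf.stalk x) c) = algebraMap F 𝒳.FunctionField c := by
  have : Nonempty (⊤ : 𝒳.X.Opens) := ⟨⟨x, trivial⟩⟩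
  exact Scheme.algebraMap_germ_eq_germToFunctionField (X := 𝒳.X) (U := ⊤) (x := x) trivial
    (𝒳.globalConst c)

lemma ord_le_ord_smul (P : 𝒳.Point) (c : F) (f : 𝒳.FunctionField) (hc : c • f ≠ 0) :
    Scheme.ord f P.1 ≤ Scheme.ord (c • f) P.1 := by
  have : Nonempty (⊤ : 𝒳.X.Opens) := ⟨⟨P.1, trivial⟩⟩
  have ha : 𝒳.globalConst c ≠ 0 := by
    intro h
    apply hc
    have hz : algebraMap F 𝒳.FunctionField c = 0 := by
      change 𝒳.X.germToFunctionField ⊤ (𝒳.globalConst c) = 0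
      rw [h, map_zero]
    rw [Algebra.smul_def, hz, zero_mul]
  exact Scheme.ord_le_smul (X := 𝒳.X) (x := P.1) (U := ⊤) trivial ha f

/-- The Riemann-Roch space `𝓛(G) = {f ≠ 0 : div(f) + G ≥ 0} ∪ {0}`. -/
noncomputable def L (G : 𝒳.Divisor) : Submodule F 𝒳.FunctionField where
  carrier := {f | f ≠ 0 → ∀ P : 𝒳.Point, 0 ≤ Scheme.ord f P.1 + G P}
  zero_mem' := fun h => (h rfl).elim
  add_mem' := by
    intro f g hf hg hfg P
    by_cases hf0 : f = 0
    · subst hf0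
      rw [zero_add] at hfg ⊢
      exact hg hfg P
    by_cases hg0 : g = 0
    · subst hg0
      rw [add_zero] at hfg ⊢
      exact hf hfg P
    have h := Scheme.ord_add (X := 𝒳.X) (x := P.1) hfg
    have h1 := hf hf0 P
    have h2 := hg hg0 P
    rcases min_le_iff.1 h with h | h <;> linarith
  smul_mem' := by
    intro c f hf hcf P
    have h := ord_le_ord_smul P c f hcf
    have h1 := hf (fun h0 => hcf (by rw [h0, smul_zero])) P
    linarith

/-- `ℓ(G) = dim_F 𝓛(G)`. -/
noncomputable def ell (G : 𝒳.Divisor) : ℕ := Module.finrank F (L G)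

/-- The divisor `D = P_1 + ⋯ + P_n`. -/
noncomputable def sumDivisor {n : ℕ} (P : Fin n → 𝒳.Point) : 𝒳.Divisor :=
  ∑ i, Finsupp.single (P i) 1

/-- The algebraic geometric code `C_𝒳(D, G)`, `D = P_1 + ⋯ + P_n`: the set of all words
`(f(P_1), …, f(P_n))` with `f ∈ 𝓛(G)`. -/
noncomputable def agCode {n : ℕ} (P : Fin n → 𝒳.Point) (G : 𝒳.Divisor) :
    Submodule F (Fin n → F) where
  carrier := {w | ∃ f ∈ L G, ∀ i, HasValueAt f (P i) (w i)}
  zero_mem' := ⟨0, Submodule.zero_mem _, fun i => ⟨0, by simp, by simp⟩⟩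
  add_mem' := by
    rintro v w ⟨f, hf, hv⟩ ⟨g, hg, hw⟩
    refine ⟨f + g, Submodule.add_mem _ hf hg, fun i => ?_⟩
    obtain ⟨s, rfl, hs⟩ := hv i
    obtain ⟨t, rfl, ht⟩ := hw i
    exact ⟨s + t, by simp, by simp [hs, ht]⟩
  smul_mem' := by
    rintro c w ⟨f, hf, hw⟩
    refine ⟨c • f, Submodule.smul_mem _ c hf, fun i => ?_⟩
    obtain ⟨t, ht, ht'⟩ := hw i
    refine ⟨algebraMap F _ c * t, ?_, by simp [ht']⟩
    rw [map_mul, ht, algebraMap_stalk_const, Algebra.smul_def]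

end Curve

/-! In any trellis for a linear code `C`, paths through the same vertex at depth `i` can be spliced.
So there are at least `q ^ d` vertices there, where `d = dim C - dim past - dim future`, and the
quotient of `C` by past plus future yields a trellis attaining this bound at every depth. It is
enough to find, for each ordering of the coordinates, one depth where past and future together are
small.

For an AG code, past and future at depth `i` are the images under evaluation of `L (A i)` and `L (B
i)`, where `A i` and `B i` are `G` minus complementary parts of `D`. Both evaluations have kernel `L
(G - D)`, of dimension `a`, and `A i + B i = 2G - D`. If both spaces are nonzero, the linear
Cauchy–Davenport inequality gives `ℓ(A i) + ℓ(B i) ≤ ℓ(2G - D) + 1`, which is the claim. If they are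
never both nonzero, some depth has `ℓ(A i) + ℓ(B i) ≤ 1`.

Cauchy–Davenport needs `F` to be algebraically closed in the function field. An element integral
over `F` is regular everywhere, hence a global section; by properness the global sections form a
finite field extension of `F`, and geometric irreducibility makes it trivial
(`globalConst_surjective`). -/

/-! ### Linear Cauchy–Davenport inequality -/

lemma finrank_map_of_injective {F M N : Type*} [Field F] [AddCommGroup M] [AddCommGroup N]
    [Module F M] [Module F N] {f : M →ₗ[F] N} (hf : Function.Injective f) (p : Submodule F M) :
    Module.finrank F (p.map f) = Module.finrank F p :=
  (Submodule.equivMapOfInjective f hf p).finrank_eq.symm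

/-- The linear Cauchy–Davenport inequality: if `F` is algebraically closed in `K` and `U`, `V` are
nonzero finite-dimensional `F`-subspaces of `K`, then `dim (U V) ≥ dim U + dim V - 1`. -/
theorem finrank_add_finrank_le_of_mul_le {F K : Type*} [Field F] [Field K] [Algebra F K]
    (halg : ∀ x : K, IsIntegral F x → ∃ c : F, algebraMap F K c = x)
    (W : Submodule F K) [FiniteDimensional F W] (U V : Submodule F K)
    [FiniteDimensional F U] [FiniteDimensional F V] (hU : U ≠ ⊥) (hV : V ≠ ⊥) (hW : U * V ≤ W) :
    Module.finrank F U + Module.finrank F V ≤ Module.finrank F W + 1 := by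
  obtain ⟨m, hm⟩ : ∃ m, Module.finrank F V = m := ⟨_, rfl⟩
  induction m using Nat.strong_induction_on generalizing U V with
  | _ m ih =>
  rw [Submodule.mul_le] at hW
  -- Linear Dyson transform: replace `(U, V)` by `(U + eV, V ∩ e⁻¹U)`. The sum of dimensions is
  -- unchanged and the product stays in `W`; `e` is chosen so that the new `V` is nonzero and
  -- strictly smaller.
  by_cases hstep : ∃ e : K, e ≠ 0 ∧ (∃ v ∈ V, v ≠ 0 ∧ e * v ∈ U) ∧ ∃ v ∈ V, e * v ∉ U
  · obtain ⟨e, he, ⟨v, hv, hv0, hev⟩, v', hv', hev'⟩ := hstep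
    set φ : K →ₗ[F] K := LinearMap.mulLeft F e with hφ
    have hφi : Function.Injective φ := mul_right_injective₀ he
    set U' := U ⊔ V.map φ with hU'
    set V' := V ⊓ U.comap φ with hV'
    have hmap : U ⊓ V.map φ = V'.map φ := by
      ext x
      constructor
      · rintro ⟨hx, y, hy, rfl⟩
        exact ⟨y, ⟨hy, hx⟩, rfl⟩
      · rintro ⟨y, ⟨hy, hx⟩, rfl⟩
        exact ⟨hx, y, hy, rfl⟩
    have : FiniteDimensional F V' := Submodule.finiteDimensional_of_le inf_le_left
    have hdim := Submodule.finrank_sup_add_finrank_inf_eq U (V.map φ)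
    rw [hmap, finrank_map_of_injective hφi,
      finrank_map_of_injective hφi] at hdim
    change Module.finrank F U' + _ = _ at hdim
    have hlt : V' < V := by
      refine lt_of_le_of_ne inf_le_left fun h => hev' ?_
      have : v' ∈ V' := h ▸ hv'
      exact this.2
    have := ih _ (hm ▸ Submodule.finrank_lt_finrank_of_lt hlt) U' V'
      (fun h => hU (le_bot_iff.1 (h ▸ le_sup_left)))
      (fun h => hv0 ((Submodule.mem_bot F).1 (h ▸ (⟨hv, hev⟩ : v ∈ V'))))
      (by
        rw [Submodule.mul_le]
        intro x hx y hy
        obtain ⟨u, hu, z, ⟨w, hw, rfl⟩, rfl⟩ := Submodule.mem_sup.1 hx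
        rw [add_mul]
        refine add_mem (hW _ hu _ hy.1) ?_
        have := hW _ hy.2 _ hw
        convert this using 1
        simp only [hφ, LinearMap.mulLeft_apply]
        ring) rfl
    omega
  · push Not at hstep
    obtain ⟨v, hv, hv0⟩ := Submodule.exists_mem_ne_zero_of_ne_bot hV
    obtain ⟨u, hu, hu0⟩ := Submodule.exists_mem_ne_zero_of_ne_bot hU
    -- With no admissible `e`, whenever `eV` meets `U` nontrivially it lies in `U`. Taking `e = u /
    -- v` shows that each `v' / v` stabilises the finite-dimensional `U`, so it is integral over
    -- `F`, hence constant, and `V` is a line.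
    have hstab : ∀ u ∈ U, ∀ v' ∈ V, (v' / v) * u ∈ U := by
      intro u hu v' hv'
      by_cases hu0 : u = 0
      · simp [hu0]
      have := hstep (u / v) (div_ne_zero hu0 hv0) ⟨v, hv, hv0, by field_simp; exact hu⟩ v' hv'
      convert this using 1
      ring
    have hVle : V ≤ Submodule.span F {v} := by
      intro v' hv'
      have hint : IsIntegral F (v' / v) :=
        isIntegral_of_smul_mem_submodule (M := K) (N := U)
          (fun h => hU h) ((Submodule.fg_iff_finiteDimensional _).2 inferInstance) (v' / v)
          (fun u hu => hstab u hu v' hv')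
      obtain ⟨c, hc⟩ := halg _ hint
      rw [Submodule.mem_span_singleton]
      exact ⟨c, by rw [Algebra.smul_def, hc]; field_simp⟩
    have h1 : Module.finrank F V ≤ 1 :=
      (Submodule.finrank_mono hVle).trans_eq (finrank_span_singleton hv0)
    have h2 : U.map (LinearMap.mulRight F v) ≤ W := by
      rintro _ ⟨x, hx, rfl⟩
      exact hW x hx v hv
    have h3 := Submodule.finrank_mono h2
    rw [finrank_map_of_injective (mul_left_injective₀ hv0)] at h3
    omega

/-! ### State spaces and the minimal trellis of a linear code -/

section Code

variable {F : Type u} [Field F] {n : ℕ} (C : Submodule F (Fin n → F))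

/-- The codewords of `C` supported on the coordinates before depth `i`. -/
def pastCode (i : ℕ) : Submodule F (Fin n → F) where
  carrier := {w | w ∈ C ∧ ∀ j : Fin n, i ≤ j → w j = 0}
  zero_mem' := ⟨C.zero_mem, fun _ _ => rfl⟩
  add_mem' := fun ha hb => ⟨C.add_mem ha.1 hb.1, fun j hj => by simp [ha.2 j hj, hb.2 j hj]⟩
  smul_mem' := fun c _ ha => ⟨C.smul_mem c ha.1, fun j hj => by simp [ha.2 j hj]⟩

/-- The codewords of `C` supported on the coordinates from depth `i` on. -/
def futureCode (i : ℕ) : Submodule F (Fin n → F) where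
  carrier := {w | w ∈ C ∧ ∀ j : Fin n, j < i → w j = 0}
  zero_mem' := ⟨C.zero_mem, fun _ _ => rfl⟩
  add_mem' := fun ha hb => ⟨C.add_mem ha.1 hb.1, fun j hj => by simp [ha.2 j hj, hb.2 j hj]⟩
  smul_mem' := fun c _ ha => ⟨C.smul_mem c ha.1, fun j hj => by simp [ha.2 j hj]⟩

variable {C}

lemma mem_pastCode {i : ℕ} {w : Fin n → F} :
    w ∈ pastCode C i ↔ w ∈ C ∧ ∀ j : Fin n, i ≤ j → w j = 0 := Iff.rfl

lemma mem_futureCode {i : ℕ} {w : Fin n → F} :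
    w ∈ futureCode C i ↔ w ∈ C ∧ ∀ j : Fin n, j < i → w j = 0 := Iff.rfl

variable (C)

/-- The state space at depth `i` of the minimal trellis of `C`. -/
abbrev StateSpace (i : ℕ) : Type u :=
  C ⧸ (pastCode C i ⊔ futureCode C i).comap C.subtype

lemma pastCode_sup_futureCode_le (i : ℕ) : pastCode C i ⊔ futureCode C i ≤ C :=
  sup_le (fun _ h => h.1) (fun _ h => h.1)

lemma finrank_stateSpace (i : ℕ) :
    Module.finrank F (StateSpace C i) + Module.finrank F (pastCode C i) +
      Module.finrank F (futureCode C i) = Module.finrank F C := by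
  have h1 := Submodule.finrank_quotient_add_finrank
    ((pastCode C i ⊔ futureCode C i).comap C.subtype)
  have h2 := Submodule.finrank_sup_add_finrank_inf_eq (pastCode C i) (futureCode C i)
  have h3 : pastCode C i ⊓ futureCode C i = ⊥ := by
    rw [eq_bot_iff]
    rintro w ⟨⟨-, hp⟩, -, hf⟩
    rw [Submodule.mem_bot]
    ext j
    rcases le_or_gt i j with h | h
    exacts [hp j h, hf j h]
  have h4 := (Submodule.comapSubtypeEquivOfLe (pastCode_sup_futureCode_le C i)).finrank_eq
  rw [h3, finrank_bot] at h2
  change Module.finrank F (StateSpace C i) + _ = _ at h1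
  omega

/-- Two codewords whose paths meet at depth `i` have the same state at depth `i`. -/
lemma Trellis.sub_mem_of_meet {T : Trellis F n} (hT : T.Represents C) {p p' : ∀ j, T.V j}
    {w w' : Fin n → F} (hp : ∀ j : Fin n, T.E j (p j.castSucc) (w j) (p j.succ))
    (hp' : ∀ j : Fin n, T.E j (p' j.castSucc) (w' j) (p' j.succ)) (i : Fin (n + 1))
    (hi : p i = p' i) : w - w' ∈ pastCode C i ⊔ futureCode C i := by
  have hw : w ∈ C := by
    have : w ∈ T.words := ⟨p, hp⟩
    rwa [hT] at this
  -- Follow `p'` up to depth `i` and `p` afterwards. The spliced word differs from `w` only before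
  -- depth `i`, and from `w'` only from depth `i` on.
  let q : ∀ j, T.V j := fun j => if j < i then p' j else p j
  have hq : (fun j : Fin n => if (j : ℕ) < i then w' j else w j) ∈ C := by
    have : (fun j : Fin n => if (j : ℕ) < i then w' j else w j) ∈ T.words := by
      refine ⟨q, fun j => ?_⟩
      by_cases h : (j : ℕ) < i
      · have h1 : q j.castSucc = p' j.castSucc := if_pos (Fin.lt_def.2 h)
        have h2 : q j.succ = p' j.succ := by
          by_cases h' : j.succ < i
          · exact if_pos h'
          · have : j.succ = i := le_antisymm (Fin.le_def.2 h) (not_lt.1 h')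
            subst this
            exact (if_neg h').trans hi
        rw [h1, h2]
        simpa only [h, if_true] using hp' j
      · have h1 : q j.castSucc = p j.castSucc := if_neg fun h' => h (Fin.lt_def.1 h')
        have h2 : q j.succ = p j.succ :=
          if_neg fun h' => h ((Nat.lt_succ_self _).trans (Fin.lt_def.1 h'))
        rw [h1, h2]
        simpa only [h, if_false] using hp j
    rwa [hT] at this
  have hw' : w' ∈ C := by
    have : w' ∈ T.words := ⟨p', hp'⟩
    rwa [hT] at this
  rw [Submodule.mem_sup]
  refine ⟨_, ⟨C.sub_mem hw hq, fun j hj => ?_⟩, _, ⟨C.sub_mem hq hw', fun j hj => ?_⟩,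
    sub_add_sub_cancel _ _ _⟩
  · simp [not_lt.2 hj]
  · simp [hj]

/-- Choose a codeword and a path for each class: by splicing, distinct classes pass through distinct
vertices at depth `i`. -/
lemma Trellis.card_stateSpace_le {T : Trellis F n} (hT : T.Represents C) (i : Fin (n + 1)) :
    Nat.card (StateSpace C i) ≤ Nat.card (T.V i) := by
  have := T.finite i
  have hpath : ∀ x : StateSpace C i, ∃ (c : C) (p : ∀ j, T.V j),
      (∀ j : Fin n, T.E j (p j.castSucc) (c.1 j) (p j.succ)) ∧ Submodule.Quotient.mk c = x := by
    intro x
    obtain ⟨c, rfl⟩ := Submodule.Quotient.mk_surjective _ x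
    obtain ⟨p, hp⟩ : c.1 ∈ T.words := by rw [hT]; exact c.2
    exact ⟨c, p, hp, rfl⟩
  choose c p hp hc using hpath
  refine Nat.card_le_card_of_injective (fun x => p x i) fun x y hxy => ?_
  rw [← hc x, ← hc y, Submodule.Quotient.eq]
  exact Trellis.sub_mem_of_meet C hT (hp x) (hp y) i hxy

lemma Trellis.one_lt_card [Finite F] : (1 : ℝ) < Nat.card F := by
  exact_mod_cast Finite.one_lt_card

lemma Trellis.finrank_le_s [Finite F] {T : Trellis F n} (hT : T.Represents C) (i : Fin (n + 1)) :
    (Module.finrank F (StateSpace C i) : ℝ) ≤ T.s i := by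
  have h := Trellis.card_stateSpace_le C hT i
  rw [Module.natCard_eq_pow_finrank (K := F)] at h
  have h1 := Trellis.one_lt_card (F := F)
  rw [Trellis.s, Real.le_logb_iff_rpow_le h1, Real.rpow_natCast]
  · exact_mod_cast h
  · exact_mod_cast lt_of_lt_of_le (pow_pos Nat.card_pos _) h

lemma Trellis.finrank_le_stateComplexity [Finite F] {T : Trellis F n} (hT : T.Represents C)
    (i : Fin (n + 1)) :
    (Module.finrank F (StateSpace C i) : ℝ) ≤ T.stateComplexity :=
  (Trellis.finrank_le_s C hT i).trans (Finset.le_sup' T.s (Finset.mem_univ i))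

lemma natCard_stateSpace_zero : Nat.card (StateSpace C 0) = 1 := by
  rw [Nat.card_eq_one_iff_unique]
  refine ⟨?_, inferInstance⟩
  rw [Submodule.Quotient.subsingleton_iff, eq_top_iff]
  exact fun c _ => Submodule.mem_sup_right (T := futureCode C 0) ⟨c.2, fun j hj => by omega⟩

lemma natCard_stateSpace_last : Nat.card (StateSpace C n) = 1 := by
  rw [Nat.card_eq_one_iff_unique]
  refine ⟨?_, inferInstance⟩
  rw [Submodule.Quotient.subsingleton_iff, eq_top_iff]
  exact fun c _ => Submodule.mem_sup_left (T := futureCode C n) ⟨c.2, fun j hj => by omega⟩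

instance [Finite F] (i : ℕ) : Finite (StateSpace C i) :=
  Finite.of_surjective _ (Submodule.mkQ_surjective _)

/-- The state at depth `i` of a codeword, numbered. -/
noncomputable def stateIndex [Finite F] (i : ℕ) (c : C) : Fin (Nat.card (StateSpace C i)) :=
  Finite.equivFin (StateSpace C i) (Submodule.Quotient.mk c)

lemma stateIndex_eq_iff [Finite F] {i : ℕ} {c d : C} :
    stateIndex C i c = stateIndex C i d ↔ (c - d : Fin n → F) ∈ pastCode C i ⊔ futureCode C i := by
  rw [stateIndex, stateIndex, EmbeddingLike.apply_eq_iff_eq, Submodule.Quotient.eq]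
  rfl

lemma stateIndex_surjective [Finite F] (i : ℕ) : Function.Surjective (stateIndex C i) :=
  (Finite.equivFin (StateSpace C i)).surjective.comp (Submodule.Quotient.mk_surjective _)

/-- The trellis of `C` whose states at depth `i` are the classes of codewords modulo the past and
future subcodes. -/
noncomputable def minimalTrellis [Finite F] : Trellis F n where
  -- Vertices must live in `Type`, whereas `StateSpace C i` lives in `Type u`; hence the numbering.
  V i := Fin (Nat.card (StateSpace C i))
  finite _ := inferInstance
  E i v x v' := ∃ c : C, stateIndex C i c = v ∧ c.1 i = x ∧ stateIndex C (i + 1) c = v'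
  start := by rw [Nat.card_fin]; exact natCard_stateSpace_zero C
  finish := by rw [Nat.card_fin]; exact natCard_stateSpace_last C
  on_path i v := by
    obtain ⟨c, rfl⟩ := stateIndex_surjective C i v
    exact ⟨fun j => stateIndex C j c, c.1, fun j => ⟨c, rfl, rfl, rfl⟩, rfl⟩

/-- The edges of one path may come from different codewords, so a single codeword reading the path's
labels is built up one depth at a time. -/
lemma minimalTrellis_represents [Finite F] : (minimalTrellis C).Represents C := by
  ext w
  constructor
  · rintro ⟨p, hp⟩
    have key : ∀ m (hm : m ≤ n), ∃ d : C, stateIndex C m d = p ⟨m, Nat.lt_succ_of_le hm⟩ ∧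
        ∀ j : Fin n, (j : ℕ) < m → d.1 j = w j := by
      intro m
      induction m with
      | zero =>
        intro _
        obtain ⟨d, hd⟩ := stateIndex_surjective C 0 (p ⟨0, Nat.lt_succ_of_le (Nat.zero_le n)⟩)
        exact ⟨d, hd, fun j hj => by omega⟩
      | succ m ih =>
        intro hm
        obtain ⟨d, hd, hdw⟩ := ih (Nat.le_of_succ_le hm)
        obtain ⟨c, hc, hcw, hc'⟩ := hp ⟨m, hm⟩
        have hdc := (stateIndex_eq_iff C).1 (hd.trans hc.symm)
        obtain ⟨a, ha, b, hb, hab⟩ := Submodule.mem_sup.1 hdc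
        -- Since `d - c = a + b` with `a` past and `b` future, `c + a` agrees with `d` before depth
        -- `m` and with `c` from there on. Adding the past word `a` leaves the state at depth `m +
        -- 1` unchanged.
        refine ⟨c + ⟨a, ha.1⟩, ?_, fun j hj => ?_⟩
        · refine Eq.trans ?_ hc'
          rw [stateIndex_eq_iff]
          refine Submodule.mem_sup_left ?_
          have : a ∈ pastCode C (m + 1) := ⟨ha.1, fun j hj => ha.2 j (by omega)⟩
          simpa using this
        · rcases Nat.lt_succ_iff_lt_or_eq.1 hj with h | h
          · have := congrFun hab j
            simp only [Pi.add_apply, hb.2 j h, add_zero, Pi.sub_apply] at this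
            simp [this, hdw j h]
          · have : j = ⟨m, hm⟩ := Fin.ext h
            subst this
            simp [ha.2 ⟨m, hm⟩ le_rfl, hcw]
    obtain ⟨d, -, hd⟩ := key n le_rfl
    have : d.1 = w := funext fun j => hd j j.2
    exact this ▸ d.2
  · intro hw
    exact ⟨fun j => stateIndex C j ⟨w, hw⟩, fun j => ⟨⟨w, hw⟩, rfl, rfl, rfl⟩⟩

/-- Its vertex counts attain the lower bound of `Trellis.finrank_le_s` at every depth. -/
lemma minimalTrellis_isMinimal [Finite F] : (minimalTrellis C).IsMinimal C := by
  refine ⟨minimalTrellis_represents C, fun T hT i => ?_⟩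
  refine le_of_eq_of_le ?_ (Trellis.finrank_le_s C hT i)
  have h1 := Trellis.one_lt_card (F := F)
  change Real.logb _ (Nat.card (Fin (Nat.card (StateSpace C i)))) = _
  rw [Nat.card_fin, Module.natCard_eq_pow_finrank (K := F) (V := StateSpace C i), Nat.cast_pow, Real.logb_pow,
    Real.logb_self_eq_one h1, mul_one]

/-- A lower bound for the trellis state complexity from the dimensions of past and future subcodes
of all reorderings. -/
lemma le_trellisStateComplexity [Finite F] {b : ℝ}
    (h : ∀ σ : Equiv.Perm (Fin n), ∃ i ≤ n,
      b + Module.finrank F (pastCode (permutedCode C σ) i) +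
        Module.finrank F (futureCode (permutedCode C σ) i) ≤
        Module.finrank F (permutedCode C σ)) :
    b ≤ trellisStateComplexity C := by
  -- The infimum of the empty set in `ℝ` is `0`, so a minimal trellis has to be exhibited.
  refine le_csInf ⟨_, 1, _, minimalTrellis_isMinimal _, rfl⟩ ?_
  rintro _ ⟨σ, T, hT, rfl⟩
  obtain ⟨i, hi, h⟩ := h σ
  have h1 := Trellis.finrank_le_stateComplexity _ hT.1 ⟨i, Nat.lt_succ_of_le hi⟩
  have h2 := finrank_stateSpace (permutedCode C σ) i
  rify at h2
  change (Module.finrank F (StateSpace (permutedCode C σ) i) : ℝ) ≤ _ at h1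
  linarith

end Code

/-! ### A triviality criterion for constants -/

/-- In a commutative `F`-algebra `E` over a finite field such that `Spec (E ⊗ E)` is irreducible, an
element satisfying `x ^ q ^ m = x` is a constant. -/
lemma mem_range_algebraMap_of_isPrime_nilradical_tensor {F E : Type*} [Field F] [CommRing E]
    [Nontrivial E] [Algebra F E] (h : (nilradical (TensorProduct F E E)).IsPrime) (p : ℕ)
    [Fact p.Prime] [CharP F p] {m : ℕ} (hm : m ≠ 0) {x : E} (hx : x ^ p ^ m = x) :
    ∃ c : F, algebraMap F E c = x := by
  have : Nontrivial (TensorProduct F E E) := ⟨⟨0, 1, fun h01 => h.ne_top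
    ((Ideal.eq_top_iff_one _).2 (h01 ▸ Ideal.zero_mem _))⟩⟩
  have : CharP (TensorProduct F E E) p := charP_of_injective_algebraMap' F p
  set z : TensorProduct F E E := x ⊗ₜ 1 - 1 ⊗ₜ x with hz
  have hp2 : 2 ≤ p ^ m := (Nat.Prime.two_le Fact.out).trans (Nat.le_self_pow hm p)
  have hzN : z ^ p ^ m = z := by
    rw [hz, sub_pow_char_pow]
    simp [hx]
  have hznil : IsNilpotent z := by
    -- One factor is nilpotent. It is not the second, because multiplication `E ⊗ E → E` kills `z`
    -- and sends that factor to `-1`.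
    have hmul : z * (z ^ (p ^ m - 1) - 1) ∈ nilradical (TensorProduct F E E) := by
      rw [mul_sub, ← pow_succ', Nat.sub_add_cancel (by omega), hzN, mul_one, sub_self]
      exact Ideal.zero_mem _
    rcases h.mem_or_mem hmul with h1 | h1
    · exact h1
    · exfalso
      have h2 := (mem_nilradical.1 h1).map (Algebra.TensorProduct.lmul' F (S := E))
      have h3 : Algebra.TensorProduct.lmul' F (S := E) z = 0 := by simp [hz]
      rw [map_sub, map_pow, h3, zero_pow (by omega), map_one, zero_sub] at h2
      exact (h2.neg.isUnit_one_sub.ne_zero) (by simp)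
  have hz0 : z = 0 := by
    obtain ⟨k, hk⟩ := hznil
    have hiter : ∀ j, z ^ (p ^ m) ^ j = z := by
      intro j
      induction j with
      | zero => simp
      | succ j ih => rw [pow_succ, pow_mul, ih, hzN]
    rw [← hiter k]
    exact pow_eq_zero_of_le (Nat.lt_pow_self (by omega)).le hk
  by_contra hc
  have hx1 : x ∉ Submodule.span F {(1 : E)} := by
    rw [Submodule.mem_span_singleton]
    rintro ⟨c, hc'⟩
    exact hc ⟨c, by rw [← hc', Algebra.smul_def, mul_one]⟩
  -- A functional with `f 1 = 0` and `f x ≠ 0`; applying `f ⊗ id` to `z = 0` gives `f x • 1 = 0`.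
  obtain ⟨f, hfx, hf⟩ := Submodule.exists_le_ker_of_notMem hx1
  have hf1 : f 1 = 0 := hf (Submodule.mem_span_singleton_self 1)
  have := congrArg (TensorProduct.lid F E ∘ f.rTensor E) hz0
  simp [hz, hf1] at this
  exact hfx this

namespace Curve

open CategoryTheory AlgebraicGeometry

variable {F : Type u} [Field F] {𝒳 : Curve F}

instance (x : 𝒳.X) : IsScalarTower F (𝒳.X.presheaf.stalk x) 𝒳.FunctionField :=
  IsScalarTower.of_algebraMap_eq fun c => (algebraMap_stalk_const x c).symm

/-! ### Orders of vanishing -/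

lemma le_ord_iff_valuation_le (P : 𝒳.Point) {f : 𝒳.FunctionField} (hf : f ≠ 0) {m : ℤ} :
    m ≤ Scheme.ord f P.1 ↔
      (IsDiscreteValuationRing.maximalIdeal (𝒳.X.presheaf.stalk P.1)).valuation
        𝒳.FunctionField f ≤ WithZero.exp (-m) := by
  rw [Scheme.le_ord_iff P.2 hf]
  change _ ≤ Ring.ordFrac (𝒳.X.presheaf.stalk P.1) f ↔ _
  rw [Ring.ordFrac_eq_valuation_inv, ← WithZero.exp_eq_coe_ofAdd, le_inv_comm₀, WithZero.exp_neg]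
  · simp
  · simpa [WithZero.pos_iff_ne_zero] using hf

lemma ord_nonneg_iff (P : 𝒳.Point) {f : 𝒳.FunctionField} (hf : f ≠ 0) :
    0 ≤ Scheme.ord f P.1 ↔
      ∃ t : 𝒳.X.presheaf.stalk P.1, algebraMap (𝒳.X.presheaf.stalk P.1) 𝒳.FunctionField t = f := by
  rw [le_ord_iff_valuation_le P hf]
  simp only [neg_zero, WithZero.exp_zero]
  refine ⟨IsDiscreteValuationRing.exists_lift_of_le_one, ?_⟩
  rintro ⟨t, rfl⟩
  exact IsDedekindDomain.HeightOneSpectrum.valuation_le_one _ _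

lemma one_le_ord_iff (P : 𝒳.Point) {t : 𝒳.X.presheaf.stalk P.1}
    (ht : algebraMap (𝒳.X.presheaf.stalk P.1) 𝒳.FunctionField t ≠ 0) :
    1 ≤ Scheme.ord (algebraMap (𝒳.X.presheaf.stalk P.1) 𝒳.FunctionField t) P.1 ↔
      𝒳.X.residue P.1 t = 0 := by
  rw [le_ord_iff_valuation_le P ht]
  have h1 : ∀ a : WithZero (Multiplicative ℤ), a ≤ WithZero.exp (-1) ↔ a < 1 := by
    intro a
    rw [← WithZero.exp_zero, ← WithZero.lt_mul_exp_iff_le (WithZero.exp_ne_zero),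
      ← WithZero.exp_add]
    rfl
  rw [h1, IsDedekindDomain.HeightOneSpectrum.valuation_lt_one_iff_mem]
  exact (IsLocalRing.residue_eq_zero_iff t).symm

lemma exists_ord_eq_one (P : 𝒳.Point) : ∃ π : 𝒳.FunctionField, π ≠ 0 ∧ Scheme.ord π P.1 = 1 := by
  obtain ⟨π, hπ⟩ := (IsDiscreteValuationRing.maximalIdeal
    (𝒳.X.presheaf.stalk P.1)).valuation_exists_uniformizer 𝒳.FunctionField
  have h0 : π ≠ 0 := by
    rintro rfl
    simp [WithZero.exp_ne_zero.symm] at hπ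
  refine ⟨π, h0, le_antisymm ?_ ?_⟩
  · by_contra h
    have h2 : (2 : ℤ) ≤ Scheme.ord π P.1 := by omega
    rw [le_ord_iff_valuation_le P h0, hπ, WithZero.exp_le_exp] at h2
    omega
  · rw [le_ord_iff_valuation_le P h0, hπ]

lemma ord_one (P : 𝒳.Point) : Scheme.ord (1 : 𝒳.FunctionField) P.1 = 0 := by
  have := Scheme.ord_mul (x := P.1) (one_ne_zero (α := 𝒳.FunctionField)) one_ne_zero
  rw [one_mul] at this
  omega

lemma ord_pow (P : 𝒳.Point) {f : 𝒳.FunctionField} (hf : f ≠ 0) (m : ℕ) :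
    Scheme.ord (f ^ m) P.1 = m * Scheme.ord f P.1 := by
  induction m with
  | zero => simp [ord_one]
  | succ m ih => rw [pow_succ, Scheme.ord_mul (pow_ne_zero _ hf) hf, ih]; push_cast; ring

lemma ord_zpow (P : 𝒳.Point) {f : 𝒳.FunctionField} (hf : f ≠ 0) (m : ℤ) :
    Scheme.ord (f ^ m) P.1 = m * Scheme.ord f P.1 := by
  obtain ⟨m, rfl | rfl⟩ := m.eq_nat_or_neg
  · simpa using ord_pow P hf m
  · have h := Scheme.ord_mul (x := P.1) (zpow_ne_zero (-m : ℤ) hf) (pow_ne_zero m hf)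
    rw [← zpow_natCast, ← zpow_add₀ hf, neg_add_cancel, zpow_zero, ord_one, zpow_natCast,
      ord_pow P hf] at h
    linarith

/-! ### Points -/

/-- Taking closures embeds the points, strictly monotonically, into the irreducible closed subsets,
whose chains are bounded by the dimension. -/
lemma coheight_le_one (x : 𝒳.X) : Order.coheight x ≤ 1 := by
  have h1 : Order.krullDim 𝒳.X ≤ topologicalKrullDim 𝒳.X := by
    refine Order.krullDim_le_of_strictMono
      (fun x => ⟨closure {x}, isIrreducible_singleton.closure, isClosed_closure⟩) ?_
    rintro x y ⟨hxy, hyx⟩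
    refine lt_of_le_not_ge ?_ ?_
    · exact (specializes_iff_closure_subset (x := y) (y := x)).1 hxy
    · exact fun h => hyx ((specializes_iff_closure_subset (x := x) (y := y)).2 h)
  have h2 := (Order.coheight_le_krullDim x).trans (h1.trans_eq 𝒳.dim_eq_one)
  exact_mod_cast h2

lemma eq_genericPoint_or_coheight_eq_one (x : 𝒳.X) :
    x = genericPoint 𝒳.X ∨ Order.coheight x = 1 := by
  by_cases h : Order.coheight x = 0
  · left
    have hmax := Order.coheight_eq_zero.1 h
    have h1 : genericPoint 𝒳.X ⤳ x := genericPoint_specializes x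
    have h2 : x ⤳ genericPoint 𝒳.X := hmax h1
    exact (h2.antisymm h1).eq
  · exact Or.inr (le_antisymm (coheight_le_one x) (Order.one_le_iff_ne_zero.2 h))

lemma isClosed_point (P : 𝒳.Point) : IsClosed {P.1} := by
  refine isClosed_of_closure_subset fun y hy => ?_
  have hPy : P.1 ⤳ y := specializes_iff_mem_closure.2 hy
  by_contra hne
  have hlt : y < P.1 := ⟨hPy, fun h => hne ((show y ⤳ P.1 from h).antisymm hPy).eq⟩
  have h1 := Order.coheight_add_one_le hlt
  rw [P.2] at h1
  exact absurd (h1.trans (coheight_le_one y)) (by norm_num)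

/-! ### Regular functions are global sections -/

/-- Local representatives all have germ `f` at the generic point, which lies in every nonempty open
set. Taking germs there is injective by integrality, so the representatives agree on overlaps and
glue. -/
lemma exists_globalSection {f : 𝒳.FunctionField}
    (hf : ∀ x : 𝒳.X, ∃ t : 𝒳.X.presheaf.stalk x,
      algebraMap (𝒳.X.presheaf.stalk x) 𝒳.FunctionField t = f) :
    ∃ s : Γ(𝒳.X, ⊤), 𝒳.X.presheaf.germ ⊤ (genericPoint 𝒳.X) trivial s = f := by
  have h1 : ∀ x : 𝒳.X, ∃ (U : 𝒳.X.Opens) (_ : x ∈ U) (s : Γ(𝒳.X, U)),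
      ∀ h : genericPoint 𝒳.X ∈ U, 𝒳.X.presheaf.germ U (genericPoint 𝒳.X) h s = f := by
    intro x
    obtain ⟨t, ht⟩ := hf x
    obtain ⟨U, hU, s, rfl⟩ := 𝒳.X.presheaf.exists_germ_eq t
    have : Nonempty U := ⟨⟨x, hU⟩⟩
    refine ⟨U, hU, s, fun h => ?_⟩
    rw [← ht]
    exact (Scheme.algebraMap_germ_eq_germToFunctionField _ hU s).symm
  choose U hU s hs using h1
  have hgen : ∀ x, genericPoint 𝒳.X ∈ U x := fun x =>
    (genericPoint_specializes x).mem_open (U x).isOpen (hU x)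
  obtain ⟨g, hg, -⟩ := 𝒳.X.sheaf.existsUnique_gluing' U ⊤ (fun x => homOfLE le_top)
    (fun x _ => TopologicalSpace.Opens.mem_iSup.2 ⟨x, hU x⟩) s (by
      intro x y
      apply germ_injective_of_isIntegral 𝒳.X (genericPoint 𝒳.X)
        (show genericPoint 𝒳.X ∈ U x ⊓ U y from ⟨hgen x, hgen y⟩)
      erw [TopCat.Presheaf.germ_res_apply, TopCat.Presheaf.germ_res_apply]
      rw [hs, hs])
  refine ⟨g, ?_⟩
  have h2 := hg (genericPoint 𝒳.X)
  rw [← hs (genericPoint 𝒳.X) (hgen _), ← h2]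
  erw [TopCat.Presheaf.germ_res_apply]

lemma exists_globalSection_of_mem_L_zero {f : 𝒳.FunctionField} (hf : f ∈ L (0 : 𝒳.Divisor)) :
    ∃ s : Γ(𝒳.X, ⊤), 𝒳.X.presheaf.germ ⊤ (genericPoint 𝒳.X) trivial s = f := by
  refine exists_globalSection fun x => ?_
  by_cases h0 : f = 0
  · exact ⟨0, by rw [h0, map_zero]⟩
  rcases eq_genericPoint_or_coheight_eq_one x with rfl | hx
  · refine ⟨f, ?_⟩
    simp [RingHom.algebraMap_toAlgebra]
  · have := hf h0 ⟨x, hx⟩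
    simp only [Finsupp.coe_zero, Pi.zero_apply, add_zero] at this
    exact (ord_nonneg_iff ⟨x, hx⟩ h0).1 this

end Curve

/-! ### The field of constants -/

namespace Curve

open CategoryTheory AlgebraicGeometry Limits

variable {F : Type u} [Field F] {𝒳 : Curve F}

lemma toSpecΓ_SpecMap_globalConst :
    𝒳.X.toSpecΓ ≫ Spec.map (CommRingCat.ofHom 𝒳.globalConst) = 𝒳.π := by
  have h : CommRingCat.ofHom 𝒳.globalConst =
    (Scheme.ΓSpecIso (CommRingCat.of F)).inv ≫ 𝒳.π.appTop := rfl
  rw [h, Spec.map_comp, ← Scheme.toSpecΓ_naturality_assoc]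
  erw [toSpecΓ_SpecMap_ΓSpecIso_inv]
  exact Category.comp_id _

lemma finite_globalConst : 𝒳.globalConst.Finite := by
  have h1 := finite_appTop_of_universallyClosed F 𝒳.π
  refine RingHom.Finite.comp h1 (RingHom.Finite.of_surjective _ ?_)
  exact (Scheme.ΓSpecIso (CommRingCat.of F)).symm.commRingCatIsoToRingEquiv.surjective

-- Put `E = Γ(𝒳.X, ⊤)`, a field through whose spectrum the structure map factors. The base change of
-- the curve to `E` is irreducible and is also the pullback of `𝒳.X → Spec E` along `Spec (E ⊗ E) →
-- Spec E`. As `𝒳.X → Spec E` is surjective, this pullback maps onto `Spec (E ⊗ E)`.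
variable (𝒳) in
lemma isPrime_nilradical_tensor_globalSections :
    letI : Algebra F Γ(𝒳.X, ⊤) := 𝒳.globalConst.toAlgebra
    (nilradical (TensorProduct F Γ(𝒳.X, ⊤) Γ(𝒳.X, ⊤))).IsPrime := by
  let : Algebra F Γ(𝒳.X, ⊤) := 𝒳.globalConst.toAlgebra
  let : Field Γ(𝒳.X, ⊤) := (isField_of_universallyClosed F 𝒳.π).toField
  let g : Spec (.of Γ(𝒳.X, ⊤)) ⟶ Spec (.of F) :=
    Spec.map (CommRingCat.ofHom (algebraMap F Γ(𝒳.X, ⊤)))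
  have hsurj : Surjective 𝒳.X.toSpecΓ := by
    refine ⟨fun y => ⟨Nonempty.some inferInstance, ?_⟩⟩
    have : Subsingleton (PrimeSpectrum Γ(𝒳.X, ⊤)) := inferInstance
    exact this.elim _ _
  have hpb : IsPullback (pullback.fst 𝒳.X.toSpecΓ (pullback.fst g g))
      (pullback.snd 𝒳.X.toSpecΓ (pullback.fst g g) ≫ pullback.snd g g) 𝒳.π g := by
    have := ((IsPullback.of_hasPullback 𝒳.X.toSpecΓ (pullback.fst g g)).flip.paste_horiz
      (IsPullback.of_hasPullback g g).flip).flip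
    rwa [show 𝒳.X.toSpecΓ ≫ g = 𝒳.π from toSpecΓ_SpecMap_globalConst] at this
  have h1 : IrreducibleSpace ↥(pullback 𝒳.X.toSpecΓ (pullback.fst g g)) :=
    𝒳.geometricallyIrreducible.geometrically_irreducibleSpace g _ _ hpb
  have h2 : IrreducibleSpace ↥(pullback g g) :=
    (pullback.snd 𝒳.X.toSpecΓ (pullback.fst g g)).surjective.irreducibleSpace
      (Scheme.Hom.continuous _)
  have h3 : IrreducibleSpace
      (PrimeSpectrum (TensorProduct F Γ(𝒳.X, ⊤) Γ(𝒳.X, ⊤))) :=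
    (pullbackSpecIso F Γ(𝒳.X, ⊤) Γ(𝒳.X, ⊤)).hom.homeomorph.irreducibleSpace_iff.1 h2
  exact PrimeSpectrum.irreducibleSpace_iff_isPrime_nilradical.1 h3

/-- The global sections form a finite field, of order `p ^ m` say, so each of them satisfies `x ^ p
^ m = x` and the tensor-square criterion applies. -/
lemma globalConst_surjective [Finite F] : Function.Surjective 𝒳.globalConst := by
  intro x
  let : Algebra F Γ(𝒳.X, ⊤) := 𝒳.globalConst.toAlgebra
  have hfin : Module.Finite F Γ(𝒳.X, ⊤) := finite_globalConst
  have hnil := isPrime_nilradical_tensor_globalSections 𝒳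
  have hE := isField_of_universallyClosed F 𝒳.π
  let : Field Γ(𝒳.X, ⊤) := hE.toField
  have : Finite Γ(𝒳.X, ⊤) := Module.finite_of_finite F
  let := Fintype.ofFinite Γ(𝒳.X, ⊤)
  obtain ⟨p, hp⟩ := CharP.exists F
  have hprime : Fact p.Prime := ⟨(CharP.char_is_prime_or_zero F p).resolve_right
    (fun h => by subst h; exact absurd (CharP.charP_to_charZero F) (fun _ => not_finite F))⟩
  have : CharP Γ(𝒳.X, ⊤) p := charP_of_injective_algebraMap' F p
  obtain ⟨m, -, hm⟩ := FiniteField.card Γ(𝒳.X, ⊤) p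
  exact mem_range_algebraMap_of_isPrime_nilradical_tensor hnil p m.ne_zero
    (by rw [← hm]; exact FiniteField.pow_card x)

lemma exists_const_of_mem_L_zero [Finite F] {f : 𝒳.FunctionField} (hf : f ∈ L (0 : 𝒳.Divisor)) :
    ∃ c : F, algebraMap F 𝒳.FunctionField c = f := by
  obtain ⟨s, rfl⟩ := exists_globalSection_of_mem_L_zero hf
  obtain ⟨c, rfl⟩ := globalConst_surjective s
  exact ⟨c, rfl⟩

/-- The constant field is algebraically closed in the function field. -/
lemma exists_const_of_isIntegral [Finite F] {f : 𝒳.FunctionField} (hf : IsIntegral F f) :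
    ∃ c : F, algebraMap F 𝒳.FunctionField c = f := by
  -- Each local ring at a closed point is integrally closed, so `f` has no poles.
  refine exists_const_of_mem_L_zero fun h0 P => ?_
  simp only [Finsupp.coe_zero, Pi.zero_apply, add_zero]
  rw [ord_nonneg_iff P h0]
  exact (IsIntegrallyClosed.isIntegral_iff (R := 𝒳.X.presheaf.stalk P.1)).1 hf.tower_top

/-! ### Finite-dimensionality of Riemann–Roch spaces -/

/-- Nullstellensatz: the spectrum of the residue field at a closed point is of finite type over `F`,
hence finite. -/
lemma finiteDimensional_residueField (P : 𝒳.Point) :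
    Module.Finite F (IsLocalRing.ResidueField (𝒳.X.presheaf.stalk P.1)) := by
  have hP := isClosed_point P
  have hfin : IsFinite (𝒳.X.fromSpecResidueField P.1 ≫ 𝒳.π) := by
    rw [isClosed_singleton_iff_isClosedImmersion] at hP
    rw [isFinite_iff_locallyOfFiniteType_of_jacobsonSpace]
    infer_instance
  have h : 𝒳.X.fromSpecResidueField P.1 ≫ 𝒳.π = Spec.map
      (CommRingCat.ofHom 𝒳.globalConst ≫ 𝒳.X.presheaf.germ ⊤ P.1 trivial ≫ 𝒳.X.residue P.1) := by
    conv_lhs => rw [← toSpecΓ_SpecMap_globalConst]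
    simp [Scheme.fromSpecResidueField, Scheme.fromSpecStalk_toSpecΓ_assoc, Spec.map_comp]
  rw [h, IsFinite.SpecMap_iff] at hfin
  exact hfin

lemma L_mono {A B : 𝒳.Divisor} (h : A ≤ B) : L A ≤ L B := fun f hf h0 P => by
  have h1 := hf h0 P
  have h2 := h P
  omega

lemma mul_mem_L {A B : 𝒳.Divisor} {f g : 𝒳.FunctionField} (hf : f ∈ L A) (hg : g ∈ L B) :
    f * g ∈ L (A + B) := by
  intro h0 P
  have hf0 := left_ne_zero_of_mul h0
  have hg0 := right_ne_zero_of_mul h0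
  rw [Scheme.ord_mul hf0 hg0]
  have h1 := hf hf0 P
  have h2 := hg hg0 P
  simp only [Finsupp.coe_add, Pi.add_apply]
  omega

/-- Adding a point to a divisor enlarges its Riemann–Roch space by finitely many dimensions. -/
lemma finiteDimensional_L_add_single {A : 𝒳.Divisor} (P : 𝒳.Point)
    (hA : FiniteDimensional F (L A)) : FiniteDimensional F (L (A + Finsupp.single P 1)) := by
  obtain ⟨π, hπ0, hπ⟩ := exists_ord_eq_one P
  let R := 𝒳.X.presheaf.stalk P.1
  let ι : R →ₗ[F] 𝒳.FunctionField := (IsScalarTower.toAlgHom F R 𝒳.FunctionField).toLinearMap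
  have hι : Function.Injective ι := IsFractionRing.injective R 𝒳.FunctionField
  let e := (LinearEquiv.ofInjective ι hι).symm
  -- The exponent makes `f * w` regular at `P` for every `f` in the larger space, and its residue
  -- vanishes only if `f ∈ L A`. The quotient therefore embeds in the residue field.
  let w := π ^ (A P + 1)
  have hw : w ≠ 0 := zpow_ne_zero _ hπ0
  have hmem : ∀ f : L (A + Finsupp.single P 1), LinearMap.mulRight F w f.1 ∈ ι.range := by
    intro f
    by_cases h0 : f.1 * w = 0
    · exact ⟨0, by simp [h0]⟩
    have h1 := f.2 (left_ne_zero_of_mul h0) P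
    obtain ⟨t, ht⟩ := (ord_nonneg_iff P h0).1 (by
      rw [Scheme.ord_mul (left_ne_zero_of_mul h0) hw, ord_zpow P hπ0, hπ]
      simp only [Finsupp.coe_add, Pi.add_apply, Finsupp.single_eq_same] at h1
      linarith)
    exact ⟨t, ht⟩
  let φ : L (A + Finsupp.single P 1) →ₗ[F] IsLocalRing.ResidueField R :=
    (IsScalarTower.toAlgHom F R (IsLocalRing.ResidueField R)).toLinearMap ∘ₗ e.toLinearMap ∘ₗ
      ((LinearMap.mulRight F w).domRestrict _).codRestrict ι.range hmem
  have hker : φ.ker ≤ (L A).comap (L (A + Finsupp.single P 1)).subtype := by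
    intro f hf h0 Q
    obtain ⟨t, ht⟩ := hmem f
    have hfφ : φ f = IsLocalRing.residue R t := by
      have : e (⟨LinearMap.mulRight F w f.1, hmem f⟩ : ι.range) = t := by
        rw [LinearEquiv.symm_apply_eq]
        exact Subtype.ext ht.symm
      exact congrArg (IsLocalRing.residue R) this
    rw [LinearMap.mem_ker, hfφ] at hf
    have h1 := f.2 h0 Q
    simp only [Submodule.subtype_apply]
    by_cases hQ : Q = P
    · subst hQ
      have ht' : algebraMap R 𝒳.FunctionField t = f.1 * w := ht
      have h0' : f.1 ≠ 0 := h0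
      have h2 := (one_le_ord_iff Q (t := t) (by rw [ht']; exact mul_ne_zero h0' hw)).2 hf
      rw [ht', Scheme.ord_mul h0' hw, ord_zpow Q hπ0, hπ] at h2
      change 0 ≤ Scheme.ord f.1 Q.1 + A Q
      linarith
    · simpa [Finsupp.single_apply, Ne.symm hQ] using h1
  have := finiteDimensional_residueField P
  have hk : Module.Finite F φ.ker := by
    have h1 : Module.Finite F ((L A).comap (L (A + Finsupp.single P 1)).subtype) :=
      Module.Finite.of_injective
        ((L (A + Finsupp.single P 1)).subtype.restrict fun _ h => h :
          (L A).comap (L (A + Finsupp.single P 1)).subtype →ₗ[F] L A)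
        fun x y h => Subtype.ext (Subtype.ext (congrArg (fun z : L A => z.1) h))
    exact Submodule.finiteDimensional_of_le hker
  have hr : Module.Finite F (_ ⧸ φ.ker) := Module.Finite.equiv φ.quotKerEquivRange.symm
  exact Module.Finite.of_submodule_quotient φ.ker

instance finiteDimensional_L [Finite F] (A : 𝒳.Divisor) : FiniteDimensional F (L A) := by
  have h0 : FiniteDimensional F (L (0 : 𝒳.Divisor)) := by
    refine Submodule.finiteDimensional_of_le (S₂ := Submodule.span F {1}) fun f hf => ?_
    obtain ⟨c, rfl⟩ := exists_const_of_mem_L_zero hf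
    exact Submodule.mem_span_singleton.2 ⟨c, by rw [Algebra.smul_def, mul_one]⟩
  have hnat : ∀ (P : 𝒳.Point) (m : ℕ) (B : 𝒳.Divisor), FiniteDimensional F (L B) →
      FiniteDimensional F (L (B + Finsupp.single P (m : ℤ))) := by
    intro P m B hB
    induction m with
    | zero =>
      have : B + Finsupp.single P ((0 : ℕ) : ℤ) = B := by simp
      rwa [this]
    | succ m ih =>
      have := finiteDimensional_L_add_single P ih
      rwa [add_assoc, ← Finsupp.single_add] at this
  induction A using Finsupp.induction with
  | zero => exact h0
  | single_add P m B hB hm ih =>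
    have h1 := hnat P m.toNat B ih
    -- A negative coefficient is truncated to `0`, which only enlarges the space.
    refine Submodule.finiteDimensional_of_le (L_mono (B := B + Finsupp.single P (m.toNat : ℤ)) ?_)
    rw [add_comm, add_le_add_iff_left]
    exact Finsupp.single_le_single.2 (Int.self_le_toNat m)

end Curve

namespace Curve

open CategoryTheory AlgebraicGeometry

variable {F : Type u} [Field F] {𝒳 : Curve F}

/-! ### Values at rational points -/

lemma HasValueAt.unique {P : 𝒳.Point} (hP : IsRational P) {f : 𝒳.FunctionField} {c d : F}
    (hc : HasValueAt f P c) (hd : HasValueAt f P d) : c = d := by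
  obtain ⟨s, hs, hsc⟩ := hc
  obtain ⟨t, ht, htd⟩ := hd
  have : s = t := IsFractionRing.injective (𝒳.X.presheaf.stalk P.1) 𝒳.FunctionField
    (hs.trans ht.symm)
  subst this
  exact hP.1 (hsc.symm.trans htd)

lemma HasValueAt.add {P : 𝒳.Point} {f g : 𝒳.FunctionField} {c d : F}
    (hc : HasValueAt f P c) (hd : HasValueAt g P d) : HasValueAt (f + g) P (c + d) := by
  obtain ⟨s, rfl, hs⟩ := hc
  obtain ⟨t, rfl, ht⟩ := hd
  exact ⟨s + t, by simp, by simp [hs, ht]⟩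

lemma HasValueAt.smul {P : 𝒳.Point} {f : 𝒳.FunctionField} {c : F} (d : F)
    (hc : HasValueAt f P c) : HasValueAt (d • f) P (d * c) := by
  obtain ⟨t, rfl, ht⟩ := hc
  refine ⟨algebraMap F _ d * t, ?_, by simp [ht]⟩
  rw [map_mul, algebraMap_stalk_const, Algebra.smul_def]

lemma hasValueAt_zero_iff {P : 𝒳.Point} {f : 𝒳.FunctionField} (hf : f ≠ 0) :
    HasValueAt f P 0 ↔ 1 ≤ Scheme.ord f P.1 := by
  constructor
  · rintro ⟨t, rfl, ht⟩
    exact (one_le_ord_iff P hf).2 (by simpa using ht)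
  · intro h
    obtain ⟨t, rfl⟩ := (ord_nonneg_iff P hf).1 (by omega)
    exact ⟨t, rfl, by simpa using (one_le_ord_iff P hf).1 h⟩

lemma exists_hasValueAt {P : 𝒳.Point} (hP : IsRational P) {f : 𝒳.FunctionField}
    (hf : f ≠ 0 → 0 ≤ Scheme.ord f P.1) : ∃ c, HasValueAt f P c := by
  by_cases h0 : f = 0
  · exact ⟨0, 0, by simp [h0], by simp⟩
  obtain ⟨t, rfl⟩ := (ord_nonneg_iff P h0).1 (hf h0)
  obtain ⟨c, hc⟩ := hP.2 (𝒳.X.residue P.1 t)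
  exact ⟨c, t, rfl, hc.symm⟩

/-! ### Subcodes as images of Riemann–Roch spaces -/

variable {n : ℕ} {P : Fin n → 𝒳.Point} {G : 𝒳.Divisor}

/-- The sum of the points `P j` with `j ∈ S`. -/
noncomputable def partialSumDivisor (P : Fin n → 𝒳.Point) (S : Finset (Fin n)) : 𝒳.Divisor :=
  ∑ j ∈ S, Finsupp.single (P j) 1

lemma partialSumDivisor_univ : partialSumDivisor P Finset.univ = sumDivisor P := rfl

lemma partialSumDivisor_apply (hP : Function.Injective P) (S : Finset (Fin n)) (j : Fin n) :
    partialSumDivisor P S (P j) = if j ∈ S then 1 else 0 := by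
  classical
  simp [partialSumDivisor, Finsupp.finsetSum_apply, Finsupp.single_apply, hP.eq_iff]

lemma partialSumDivisor_apply_of_notMem (S : Finset (Fin n)) {Q : 𝒳.Point}
    (hQ : ∀ j ∈ S, P j ≠ Q) : partialSumDivisor P S Q = 0 := by
  rw [partialSumDivisor, Finsupp.finsetSum_apply]
  exact Finset.sum_eq_zero fun j hj => by simp [hQ j hj]

lemma partialSumDivisor_nonneg (S : Finset (Fin n)) : 0 ≤ partialSumDivisor P S :=
  Finset.sum_nonneg fun _ _ => Finsupp.single_nonneg.2 zero_le_one

/-- The functions of `L (G - ∑_{j ∈ S} P j)` are those of `L G` vanishing at the `P j`, `j ∈ S`. -/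
lemma mem_L_sub_partialSumDivisor (hP : Function.Injective P) (hG : ∀ i, G (P i) = 0)
    (S : Finset (Fin n)) {f : 𝒳.FunctionField} :
    f ∈ L (G - partialSumDivisor P S) ↔ f ∈ L G ∧ ∀ j ∈ S, HasValueAt f (P j) 0 := by
  by_cases h0 : f = 0
  · subst h0
    exact ⟨fun _ => ⟨Submodule.zero_mem _, fun j _ => ⟨0, by simp, by simp⟩⟩,
      fun _ => Submodule.zero_mem _⟩
  constructor
  · intro hf
    refine ⟨L_mono (sub_le_self _ (partialSumDivisor_nonneg S)) hf, fun j hj => ?_⟩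
    have := hf h0 (P j)
    rw [Finsupp.sub_apply, partialSumDivisor_apply hP, if_pos hj, hG] at this
    rw [hasValueAt_zero_iff h0]
    omega
  · rintro ⟨hf, hS⟩ _ Q
    rw [Finsupp.sub_apply]
    by_cases hQ : ∃ j ∈ S, P j = Q
    · obtain ⟨j, hj, rfl⟩ := hQ
      have := (hasValueAt_zero_iff h0).1 (hS j hj)
      rw [partialSumDivisor_apply hP, if_pos hj, hG]
      omega
    · push Not at hQ
      rw [partialSumDivisor_apply_of_notMem S hQ, sub_zero]
      exact hf h0 Q

/-- Evaluation of the functions of `L G` at the points `P i`. -/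
lemma exists_evalMap (hrat : ∀ i, IsRational (P i)) (hG : ∀ i, G (P i) = 0) :
    ∃ ev : L G →ₗ[F] (Fin n → F), ∀ (f : L G) i, HasValueAt f.1 (P i) (ev f i) := by
  have h : ∀ (f : L G) i, ∃ c, HasValueAt f.1 (P i) c := fun f i =>
    exists_hasValueAt (hrat i) fun h0 => by simpa [hG i] using f.2 h0 (P i)
  choose ev hev using h
  exact ⟨{ toFun := ev
           map_add' := fun f g => funext fun i =>
             (hev (f + g) i).unique (hrat i) ((hev f i).add (hev g i))
           map_smul' := fun c f => funext fun i =>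
             (hev (c • f) i).unique (hrat i) ((hev f i).smul c) }, hev⟩

/-- The dimension of the subcode of words vanishing on a set of coordinates. -/
lemma finrank_subcode_add_ell [Finite F] (hP : Function.Injective P)
    (hrat : ∀ i, IsRational (P i)) (hG : ∀ i, G (P i) = 0) (S : Finset (Fin n))
    {C : Submodule F (Fin n → F)} (hC : ∀ w, w ∈ C ↔ w ∈ agCode P G ∧ ∀ j ∈ S, w j = 0) :
    Module.finrank F C + ell (G - sumDivisor P) = ell (G - partialSumDivisor P S) := by
  obtain ⟨ev, hev⟩ := exists_evalMap hrat hG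
  have hle : L (G - partialSumDivisor P S) ≤ L G :=
    L_mono (sub_le_self _ (partialSumDivisor_nonneg S))
  have hval : ∀ (f : L G) j, ev f j = 0 ↔ HasValueAt f.1 (P j) 0 := fun f j =>
    ⟨fun h => h ▸ hev f j, (hev f j).unique (hrat j)⟩
  -- Rank–nullity for `φ`: its kernel consists of the functions vanishing at all the `P i`, so it is
  -- `L (G - D)` whatever `S` is.
  let φ := ev ∘ₗ Submodule.inclusion hle
  have hrange : φ.range = C := by
    ext w
    rw [hC]
    constructor
    · rintro ⟨f, rfl⟩
      refine ⟨⟨f.1, hle f.2, hev (Submodule.inclusion hle f)⟩, fun j hj => ?_⟩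
      exact (hval _ j).2 (((mem_L_sub_partialSumDivisor hP hG S).1 f.2).2 j hj)
    · rintro ⟨⟨f, hf, hw⟩, hS⟩
      refine ⟨⟨f, (mem_L_sub_partialSumDivisor hP hG S).2 ⟨hf, fun j hj => hS j hj ▸ hw j⟩⟩, ?_⟩
      exact funext fun i => (hev ⟨f, hf⟩ i).unique (hrat i) (hw i)
  have hker : φ.ker.map (L (G - partialSumDivisor P S)).subtype = L (G - sumDivisor P) := by
    ext f
    rw [← partialSumDivisor_univ, mem_L_sub_partialSumDivisor hP hG]
    constructor
    · rintro ⟨f, hf, rfl⟩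
      exact ⟨hle f.2, fun j _ => (hval (Submodule.inclusion hle f) j).1 (congrFun hf j)⟩
    · rintro ⟨hf, h⟩
      refine ⟨⟨f, (mem_L_sub_partialSumDivisor hP hG S).2 ⟨hf, fun j _ => h j (Finset.mem_univ j)⟩⟩,
        ?_, rfl⟩
      exact funext fun i => (hval ⟨f, hf⟩ i).2 (h i (Finset.mem_univ i))
  have h := φ.finrank_range_add_finrank_ker
  rw [hrange, ← finrank_map_of_injective (Submodule.subtype_injective _), hker] at h
  exact h

/-! ### Choosing the depth -/

/-- `ℓ(A) + ℓ(B) ≤ ℓ(A + B) + 1` if `ℓ(A)` and `ℓ(B)` are positive. -/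
lemma ell_add_ell_le [Finite F] {A B : 𝒳.Divisor} (hA : ell A ≠ 0) (hB : ell B ≠ 0) :
    ell A + ell B ≤ ell (A + B) + 1 := by
  refine finrank_add_finrank_le_of_mul_le (fun x hx => exists_const_of_isIntegral hx)
    (L (A + B)) (L A) (L B) ?_ ?_ (Submodule.mul_le.2 fun f hf g hg => mul_mem_L hf hg)
  · exact fun h => hA (by rw [ell, h, finrank_bot])
  · exact fun h => hB (by rw [ell, h, finrank_bot])

lemma ell_mono [Finite F] {A B : 𝒳.Divisor} (h : A ≤ B) : ell A ≤ ell B :=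
  Submodule.finrank_mono (L_mono h)

/-- A word of `pastCode C (m + 1)` that vanishes at coordinate `m` lies in `pastCode C m = 0`, so
coordinate `m` determines the word. -/
lemma finrank_pastCode_succ_le (C : Submodule F (Fin n → F)) (m : Fin n)
    (h : Module.finrank F (pastCode C m) = 0) :
    Module.finrank F (pastCode C (m + 1)) ≤ 1 := by
  let φ : pastCode C (m + 1) →ₗ[F] F := LinearMap.proj m ∘ₗ (pastCode C (m + 1)).subtype
  have hφ : Function.Injective φ := by
    rw [← LinearMap.ker_eq_bot, LinearMap.ker_eq_bot']
    intro w hw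
    have hmem : w.1 ∈ pastCode C m := by
      refine ⟨w.2.1, fun j hj => ?_⟩
      rcases hj.eq_or_lt with h | h
      · rw [← Fin.ext h]
        exact hw
      · exact w.2.2 j h
    rw [Submodule.finrank_eq_zero.1 h, Submodule.mem_bot] at hmem
    exact Subtype.ext hmem
  simpa using LinearMap.finrank_le_finrank_of_injective hφ

/-- At some depth the past and future subcodes of an algebraic geometric code are small. -/
lemma exists_finrank_past_add_future_le [Finite F] (hP : Function.Injective P)
    (hrat : ∀ i, IsRational (P i)) (hG : ∀ i, G (P i) = 0) :
    ∃ i ≤ n, Module.finrank F (pastCode (agCode P G) i) +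
      Module.finrank F (futureCode (agCode P G) i) + 2 * ell (G - sumDivisor P) ≤
        ell (2 • G - sumDivisor P) + 1 := by
  let A : ℕ → 𝒳.Divisor := fun i => G - partialSumDivisor P {j | i ≤ (j : ℕ)}
  let B : ℕ → 𝒳.Divisor := fun i => G - partialSumDivisor P {j | (j : ℕ) < i}
  have hA : ∀ i, Module.finrank F (pastCode (agCode P G) i) + ell (G - sumDivisor P) = ell (A i) :=
    fun i => finrank_subcode_add_ell hP hrat hG _ fun w => by simp [mem_pastCode]
  have hB : ∀ i,
      Module.finrank F (futureCode (agCode P G) i) + ell (G - sumDivisor P) = ell (B i) :=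
    fun i => finrank_subcode_add_ell hP hrat hG _ fun w => by simp [mem_futureCode]
  have hAB : ∀ i, A i + B i = 2 • G - sumDivisor P := by
    intro i
    have h : partialSumDivisor P {j | (j : ℕ) < i} + partialSumDivisor P {j | i ≤ (j : ℕ)} =
        sumDivisor P := by
      have := Finset.sum_filter_add_sum_filter_not Finset.univ (fun j : Fin n => (j : ℕ) < i)
        fun j => (Finsupp.single (P j) 1 : 𝒳.Divisor)
      simp only [not_lt] at this
      exact this
    simp only [A, B, ← h]
    abel
  suffices h : ∃ i ≤ n, ell (A i) + ell (B i) ≤ ell (2 • G - sumDivisor P) + 1 by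
    obtain ⟨i, hi, h⟩ := h
    refine ⟨i, hi, ?_⟩
    have := hA i
    have := hB i
    omega
  by_cases hpos : ∃ i ≤ n, ell (A i) ≠ 0 ∧ ell (B i) ≠ 0
  · obtain ⟨i, hi, h1, h2⟩ := hpos
    exact ⟨i, hi, hAB i ▸ ell_add_ell_le h1 h2⟩
  push Not at hpos
  have hAn : A n = G := by
    have : partialSumDivisor P {j | n ≤ (j : ℕ)} = 0 := by
      rw [partialSumDivisor, Finset.filter_false_of_mem fun j _ => by omega, Finset.sum_empty]
    simp [A, this]
  by_cases hn : ell (A n) = 0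
  · refine ⟨n, le_rfl, ?_⟩
    have : ell (B n) ≤ ell (A n) := hAn ▸ ell_mono (sub_le_self _ (partialSumDivisor_nonneg _))
    omega
  -- Take the least `i` with `ℓ(A i) ≠ 0`; then `ℓ(B i) = 0`. It cannot be `0`, since `B 0 = G` and
  -- `ℓ(A 0) ≤ ℓ(G)`.
  classical
  have hex : ∃ i, ell (A i) ≠ 0 := ⟨n, hn⟩
  have hi := Nat.find_min' hex hn
  have hne := Nat.find_spec hex
  have hmin := fun m => Nat.find_min (m := m) hex
  generalize Nat.find hex = i at hi hne hmin
  have hBi := hpos i hi hne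
  refine ⟨i, hi, ?_⟩
  cases i with
  | zero =>
    have hB0 : B 0 = G := by simp [B, partialSumDivisor]
    have : ell (A 0) ≤ ell (B 0) := hB0 ▸ ell_mono (sub_le_self _ (partialSumDivisor_nonneg _))
    omega
  | succ m =>
    -- `ℓ(A m) = 0` forces both `a = 0` and a zero past code at depth `m`, so `ℓ(A (m + 1)) ≤ 1`;
    -- the `+ 1` in the bound absorbs it.
    have h1 := not_not.1 (hmin m m.lt_succ_self)
    have h2 := hA m
    have h3 := hA (m + 1)
    have h4 := finrank_pastCode_succ_le (agCode P G) ⟨m, hi⟩ (by simp only; omega)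
    simp only at h4
    omega

lemma permutedCode_agCode (σ : Equiv.Perm (Fin n)) :
    permutedCode (agCode P G) σ = agCode (P ∘ σ) G := by
  ext w
  constructor
  · rintro ⟨v, ⟨f, hf, hv⟩, rfl⟩
    exact ⟨f, hf, fun i => hv (σ i)⟩
  · rintro ⟨f, hf, hw⟩
    refine ⟨w ∘ σ.symm, ⟨f, hf, fun i => ?_⟩, ?_⟩
    · simpa using hw (σ.symm i)
    · ext i
      simp [LinearMap.funLeft_apply]

lemma sumDivisor_comp_perm (σ : Equiv.Perm (Fin n)) : sumDivisor (P ∘ σ) = sumDivisor P :=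
  Equiv.sum_comp σ fun i => (Finsupp.single (P i) 1 : 𝒳.Divisor)

end Curve

theorem proposition3p3 {F : Type u} [Field F] [Finite F] (𝒳 : Curve F)
    {n : ℕ} (hn : 0 < n) (P : Fin n → 𝒳.Point) (hP : Function.Injective P)
    (hrat : ∀ i, Curve.IsRational (P i))
    (G : 𝒳.Divisor) (hG : Disjoint G.support (Curve.sumDivisor P).support)
    (k : ℕ) (hk : k = Module.finrank F (Curve.agCode P G))
    (a : ℕ) (ha : a = Curve.ell (G - Curve.sumDivisor P)) :
    (k : ℝ) + 2 * (a : ℝ) - (Curve.ell (2 • G - Curve.sumDivisor P) : ℝ) - 1 ≤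
      trellisStateComplexity (Curve.agCode P G) := by
  have hG0 : ∀ i, G (P i) = 0 := by
    intro i
    by_contra h
    refine Finset.disjoint_left.1 hG (Finsupp.mem_support_iff.2 h) (Finsupp.mem_support_iff.2 ?_)
    rw [← Curve.partialSumDivisor_univ, Curve.partialSumDivisor_apply hP]
    simp
  refine le_trellisStateComplexity _ fun σ => ?_
  have hPσ : Function.Injective (P ∘ σ) := hP.comp σ.injective
  obtain ⟨i, hi, h⟩ := Curve.exists_finrank_past_add_future_le hPσ (fun i => hrat (σ i))
    (fun i => hG0 (σ i))
  have hkσ : Module.finrank F (permutedCode (Curve.agCode P G) σ) = k := by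
    rw [hk]
    exact finrank_map_of_injective (LinearMap.funLeft_injective_of_surjective F F σ σ.surjective) _
  refine ⟨i, hi, ?_⟩
  rw [hkσ, Curve.permutedCode_agCode]
  rw [Curve.sumDivisor_comp_perm, ← ha] at h
  rify at h
  linarith
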